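/- Let $\alpha_{162}$ be the only positive root of $5x^8+3x^6-32x^4+52x^2-36$; it exists, and $\alpha_{162}\approx 1.1637$. Let $b>0$ and $a/b>\alpha_{162}$ (so $a>b$), and consider the billiard in the ellipse $(x/a)^2+(y/b)^2=1$. For every $t\in\mathbb R$ there is a 3-periodic billiard trajectory $P_1(t)P_2(t)P_3(t)$ with $P_1(t)=(a\cos t,b\sin t)$, that is, three distinct points of the ellipse such that at each of them the two sides of the triangle make equal angles with the normal of the ellipse. For any such trajectories, let $X_{162}(t)$ be the triangle center $X_{162}$ of $P_1(t)P_2(t)P_3(t)$, whose trilinear coordinates are $$\frac1p:\frac1q:\frac1r,\qquad p=(s_2^2-s_3^2)(s_2^2+s_3^2-s_1^2),\quad q=(s_3^2-s_1^2)(s_3^2+s_1^2-s_2^2),\quad r=(s_1^2-s_2^2)(s_1^2+s_2^2-s_3^2),$$ where $s_i$ is the length of the side opposite to $P_i(t)$ (read as $qr:rp:pq$ if one of $p,q,r$ is zero). Then $X_{162}(t)$ moves continuously along the ellipse, and its motion is non-monotonic with respect to $P_1(t)$: there is a continuous function $\theta:\mathbb R\to\mathbb R$ with $X_{162}(t)=(a\cos\theta(t),b\sin\theta(t))$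 for all $t$, and any such $\theta$ is neither non-decreasing nor non-increasing. -/

import Mathlib

noncomputable section

namespace EllipticBilliard

/-- The Euclidean plane. -/
abbrev Plane : Type := EuclideanSpace ℝ (Fin 2)

/-- The boundary `(x/a)² + (y/b)² = 1` of the elliptic billiard with semi-axes `a`, `b`. -/
def boundary (a b : ℝ) : Set Plane :=
  {P | (P 0 / a) ^ 2 + (P 1 / b) ^ 2 = 1}

/-- The point `(a cos t, b sin t)` of the boundary with parameter `t`. -/
def point (a b t : ℝ) : Plane :=
  !₂[a * Real.cos t, b * Real.sin t]

/-- A normal vector of the ellipse at its point `P`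
(half of the gradient of `(x/a)² + (y/b)²`). -/
def normal (a b : ℝ) (P : Plane) : Plane :=
  !₂[P 0 / a ^ 2, P 1 / b ^ 2]

/-- The law of reflection at the boundary point `P` for a particle that travels along the segments
`Q P` and `P R`: the two segments make the same angle with the normal of the ellipse at `P`. -/
def Reflects (a b : ℝ) (Q P R : Plane) : Prop :=
  InnerProductGeometry.angle (Q - P) (normal a b P) =
    InnerProductGeometry.angle (R - P) (normal a b P)

/-- `P₁ P₂ P₃` is a 3-periodic billiard trajectory: three distinct points of the boundary, with the
law of reflection at each of them. -/
structure IsThreePeriodic (a b : ℝ) (P₁ P₂ P₃ : Plane) : Prop where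
  mem₁ : P₁ ∈ boundary a b
  mem₂ : P₂ ∈ boundary a b
  mem₃ : P₃ ∈ boundary a b
  ne₁₂ : P₁ ≠ P₂
  ne₂₃ : P₂ ≠ P₃
  ne₃₁ : P₃ ≠ P₁
  reflects₁ : Reflects a b P₃ P₁ P₂
  reflects₂ : Reflects a b P₁ P₂ P₃
  reflects₃ : Reflects a b P₂ P₃ P₁

/-- The point of the plane of the triangle `P₁ P₂ P₃` with trilinear coordinates `x : y : z`,
in Cartesian form `(s₁ x P₁ + s₂ y P₂ + s₃ z P₃) / (s₁ x + s₂ y + s₃ z)`, where `sᵢ` is the length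
of the side opposite to `Pᵢ`. -/
def ofTrilinears (P₁ P₂ P₃ : Plane) (x y z : ℝ) : Plane :=
  let s₁ := dist P₂ P₃
  let s₂ := dist P₃ P₁
  let s₃ := dist P₁ P₂
  (s₁ * x + s₂ * y + s₃ * z)⁻¹ •
    ((s₁ * x) • P₁ + (s₂ * y) • P₂ + (s₃ * z) • P₃)

/-- The denominator `(s₂² - s₃²) (s₂² + s₃² - s₁²)` of the first trilinear coordinate of `X₁₆₂`;
the other two arise by cyclic permutation of the side lengths. -/
def den162 (s₁ s₂ s₃ : ℝ) : ℝ :=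
  (s₂ ^ 2 - s₃ ^ 2) * (s₂ ^ 2 + s₃ ^ 2 - s₁ ^ 2)

/-- The triangle center `X₁₆₂`, with trilinear coordinates `1/p : 1/q : 1/r`, where `p`, `q`, `r`
are the values of `den162` at the three cyclic permutations of the side lengths. The coordinates
are written as `q r : r p : p q`, which is the same triple up to the factor `p q r` when none of
`p`, `q`, `r` is zero, and which still determines the center if exactly one of them vanishes
(scalene right triangles and isosceles, non-equilateral triangles; the center is then a vertex).
-/
def X162 (P₁ P₂ P₃ : Plane) : Plane :=
  let s₁ := dist P₂ P₃
  let s₂ := dist P₃ P₁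
  let s₃ := dist P₁ P₂
  let p := den162 s₁ s₂ s₃
  let q := den162 s₂ s₃ s₁
  let r := den162 s₃ s₁ s₂
  ofTrilinears P₁ P₂ P₃ (q * r) (r * p) (p * q)

/-- `θ` is a continuous choice of the parameter of the moving point `X` on the boundary. -/
def IsParameterOf (a b : ℝ) (X : ℝ → Plane) (θ : ℝ → ℝ) : Prop :=
  Continuous θ ∧ ∀ t, X t = point a b (θ t)

/-- `X` moves continuously along the boundary, and its motion is non-monotonic with respect to the
(counterclockwise) motion `t ↦ point a b t`: its parameter is neither a non-decreasing function of
`t` (motion in the same direction) nor a non-increasing one (motion in the opposite direction).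
Continuous parameters of `X` differ by constants, so the choice of `θ` does not matter. -/
def NonMonotonicMotion (a b : ℝ) (X : ℝ → Plane) : Prop :=
  (∃ θ, IsParameterOf a b X θ) ∧ ∀ θ, IsParameterOf a b X θ → ¬ Monotone θ ∧ ¬ Antitone θ

/-- The polynomial `5x⁸ + 3x⁶ - 32x⁴ + 52x² - 36`. -/
def poly162 (x : ℝ) : ℝ :=
  5 * x ^ 8 + 3 * x ^ 6 - 32 * x ^ 4 + 52 * x ^ 2 - 36

end EllipticBilliard

end

noncomputable section

namespace EllipticBilliard

open ComplexConjugate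

/-! ### The threshold polynomial -/

/-! The problem is moved to the unit circle by the affine map `pt`. For points `u`, `v` of the
circle, the cosine of the angle between the side and the normal at `pt a b u` is, up to sign and the
length of the normal, `chord u v` divided by the length of the side. The reflection law therefore
makes chord/length constant around the triangle (Joachimsthal's integral). Squared, this is a
symmetric biquadratic relation between any two vertices, and three such relations amount to `z₁z₂ +
z₂z₃ + z₃z₁ = -g`, where `g` depends only on the ellipse (`isThreePeriodic_pt_iff`).

Consequently the side lengths of the billiard triangle are proportional to the chords, and the
barycentric weights of X₁₆₂ can be computed from the chords. The three denominators add up to zero.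
This puts the center on the circle (`norm_center`), and with the triangle inequality it keeps the
total weight nonzero (`weightSum_ne_zero`), so the center moves continuously and its angle lifts to
`ℝ`.

When the first vertex is on an axis of the ellipse, the triangle is isosceles and the center
coincides with that vertex. On the major axis the angular velocity of the center is `1 - 8(1 + 2g -
g²)/((1 - g)³(2 - g))`, which is negative. A quarter turn replaces `g` by `-g`, so the same formula
gives the velocity on the minor axis. That velocity is positive exactly when a quartic in `g` is,
and this quartic is the decisive factor of `poly162 (a / b)`. Opposite signs of velocity exclude
both kinds of monotonicity. -/

theorem poly162_strictMonoOn : StrictMonoOn poly162 (Set.Ioi 0) := by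
  intro x hx y hy hxy
  simp only [Set.mem_Ioi] at hx hy
  have huv : x ^ 2 < y ^ 2 := by gcongr
  have hu : 0 < x ^ 2 := by positivity
  have hv : 0 < y ^ 2 := by positivity
  -- The cofactor of `y² - x²` in `poly162 y - poly162 x`. In `s = x² + y²` it is at least `5s³/2 +
  -- 9s²/4 - 32s + 52`, whose minimum over `s > 0` is positive and lies near `s = 9/5`.
  have key : 0 < 5 * ((x ^ 2 + y ^ 2) * ((x ^ 2) ^ 2 + (y ^ 2) ^ 2))
      + 3 * ((x ^ 2) ^ 2 + x ^ 2 * y ^ 2 + (y ^ 2) ^ 2) - 32 * (x ^ 2 + y ^ 2) + 52 := by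
    generalize x ^ 2 = u at *
    generalize y ^ 2 = v at *
    have h1 : (u + v) ^ 2 / 2 ≤ u ^ 2 + v ^ 2 := by nlinarith [sq_nonneg (u - v)]
    have h2 : (u + v) * ((u + v) ^ 2 / 2) ≤ (u + v) * (u ^ 2 + v ^ 2) := by gcongr
    have h3 : 3 / 4 * (u + v) ^ 2 ≤ u ^ 2 + u * v + v ^ 2 := by nlinarith [sq_nonneg (u - v)]
    have hs : 0 < u + v := by positivity
    generalize u + v = s at *
    nlinarith [mul_nonneg hs.le (sq_nonneg (s - 9 / 5)), sq_nonneg (s - 9 / 5)]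
  have : poly162 y - poly162 x = (y ^ 2 - x ^ 2) * (5 * ((x ^ 2 + y ^ 2) * ((x ^ 2) ^ 2 + (y ^ 2) ^ 2))
      + 3 * ((x ^ 2) ^ 2 + x ^ 2 * y ^ 2 + (y ^ 2) ^ 2) - 32 * (x ^ 2 + y ^ 2) + 52) := by
    unfold poly162; ring
  have := mul_pos (sub_pos.2 huv) key
  linarith

theorem exists_poly162_root : ∃ α : ℝ, 1.16366 < α ∧ α < 1.16374 ∧ poly162 α = 0 := by
  have hc : ContinuousOn poly162 (Set.Icc 1.16366 1.16374) := by
    unfold poly162; fun_prop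
  have h0 : (0 : ℝ) ∈ Set.Ioo (poly162 1.16366) (poly162 1.16374) := by
    constructor <;> (unfold poly162; norm_num)
  obtain ⟨α, hα, h⟩ := intermediate_value_Ioo (by norm_num) hc h0
  exact ⟨α, hα.1, hα.2, h⟩

/-- `g` is the constant `-(z₁z₂ + z₂z₃ + z₃z₁)` of the trajectories in the ellipse with semi-axes
`a`, `b`. -/
structure IsInvariant (a b g : ℝ) : Prop where
  pos : 0 < g
  lt_one : g < 1
  eq : a ^ 2 * ((3 + g) * (1 - g)) = b ^ 2 * ((3 - g) * (1 + g))

theorem exists_isInvariant {a b : ℝ} (hb : 0 < b) (hab : b < a) : ∃ g, IsInvariant a b g := by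
  have hc : ContinuousOn (fun g : ℝ => a ^ 2 * ((3 + g) * (1 - g)) - b ^ 2 * ((3 - g) * (1 + g)))
      (Set.Icc 0 1) := by fun_prop
  have h0 : (0 : ℝ) ∈ Set.Ioo
      ((fun g : ℝ => a ^ 2 * ((3 + g) * (1 - g)) - b ^ 2 * ((3 - g) * (1 + g))) 1)
      ((fun g : ℝ => a ^ 2 * ((3 + g) * (1 - g)) - b ^ 2 * ((3 - g) * (1 + g))) 0) := by
    constructor
    · norm_num; positivity
    · have : b ^ 2 < a ^ 2 := by gcongr
      norm_num; linarith
  obtain ⟨g, hg, h⟩ := intermediate_value_Ioo' zero_le_one hc h0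
  exact ⟨g, hg.1, hg.2, by simpa [sub_eq_zero] using h⟩

/-- Identifies the constant obtained from an arbitrary trajectory with `g`, knowing only that it is
positive: the difference of the two equations is `k - g` times a positive factor. -/
theorem IsInvariant.unique {a b g k : ℝ} (hg : IsInvariant a b g) (hb : 0 < b) (hab : b < a)
    (hk : 0 < k) (h : a ^ 2 * ((3 + k) * (1 - k)) = b ^ 2 * ((3 - k) * (1 + k))) : k = g := by
  have h2 : b ^ 2 < a ^ 2 := by gcongr
  have h3 : (k - g) * ((k + g) * (a ^ 2 - b ^ 2) + 2 * (a ^ 2 + b ^ 2)) = 0 := by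
    linear_combination hg.eq - h
  have h4 : 0 < (k + g) * (a ^ 2 - b ^ 2) + 2 * (a ^ 2 + b ^ 2) := by
    have := hg.pos
    have := mul_pos (add_pos hk hg.pos) (sub_pos.2 h2)
    positivity
  rcases mul_eq_zero.1 h3 with h | h
  · linarith
  · exact absurd h h4.ne'

/-- The invariant equation expresses `(a/b)²` as a rational function of `g`. After this substitution
the numerator of `poly162` splits into the quartic and a factor that is positive on `(0, 1)`. -/
theorem IsInvariant.quartic_pos {a b g : ℝ} (hg : IsInvariant a b g) (hb : 0 < b)
    (h : 0 < poly162 (a / b)) : 0 < g ^ 4 + 5 * g ^ 3 + 17 * g ^ 2 + 23 * g - 6 := by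
  have hg0 := hg.pos
  have hg1 := hg.lt_one
  have hQ : 0 < (3 + g) * (1 - g) := mul_pos (by linarith) (by linarith)
  have hy : (a / b) ^ 2 = (3 - g) * (1 + g) / ((3 + g) * (1 - g)) := by
    rw [div_pow, div_eq_div_iff (by positivity) hQ.ne']
    linarith [hg.eq]
  have hf : poly162 (a / b) * ((3 + g) * (1 - g)) ^ 4 =
      4 * (g ^ 4 + 5 * g ^ 3 + 17 * g ^ 2 + 23 * g - 6) *
        (27 - 45 * g + 51 * g ^ 2 - 23 * g ^ 3 - 2 * g ^ 4) := by
    have : poly162 (a / b) = 5 * ((a / b) ^ 2) ^ 4 + 3 * ((a / b) ^ 2) ^ 3 - 32 * ((a / b) ^ 2) ^ 2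
        + 52 * (a / b) ^ 2 - 36 := by unfold poly162; ring
    rw [this, hy]
    have h1 : 3 + g ≠ 0 := by linarith
    have h2 : 1 - g ≠ 0 := by linarith
    field_simp
    ring
  have hH : 0 < 27 - 45 * g + 51 * g ^ 2 - 23 * g ^ 3 - 2 * g ^ 4 := by
    have h1 : g ^ 3 ≤ g ^ 2 := pow_le_pow_of_le_one hg0.le hg1.le (by norm_num)
    have h2 : g ^ 4 ≤ g ^ 2 := pow_le_pow_of_le_one hg0.le hg1.le (by norm_num)
    -- The bounds on `g³` and `g⁴` leave `27 - 45g + 26g²`, with minimum at `45/52`.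
    nlinarith [sq_nonneg (g - 45 / 52)]
  have hl : 0 < poly162 (a / b) * ((3 + g) * (1 - g)) ^ 4 := by positivity
  rw [hf] at hl
  have := (mul_pos_iff_of_pos_right hH).1 hl
  linarith

/-! ### Continuous parameters -/

theorem exists_continuous_lift {W : ℝ → ℂ} (hW : Continuous W) (hn : ∀ t, ‖W t‖ = 1) :
    ∃ θ : ℝ → ℝ, Continuous θ ∧ ∀ t, W t = Complex.exp (θ t * Complex.I) := by
  have hm : ∀ t, W t ∈ Submonoid.unitSphere ℂ := fun t => by simp [Submonoid.unitSphere, hn t]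
  let f : C(ℝ, Circle) := ⟨fun t => ⟨W t, hm t⟩, hW.subtype_mk hm⟩
  obtain ⟨e, he⟩ := Circle.exp_surjective (f 0)
  obtain ⟨F, ⟨-, hF⟩, -⟩ := Circle.isCoveringMap_exp.existsUnique_continuousMap_lifts f 0 e he
  refine ⟨F, F.continuous, fun t => ?_⟩
  have := congrArg (fun z : Circle => (z : ℂ)) (congrFun hF t)
  simp only [Function.comp_apply, Circle.coe_exp] at this
  exact this.symm

open Filter Topology in
-- The lift `θ` is only known to be continuous, so its velocity is read off from the sine of its
-- increment. Just to the right of `t₀` the increment lies in `[0, π)`, where the sine is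
-- nonnegative.
theorem nonneg_of_hasDerivAt_sin {θ : ℝ → ℝ} {t₀ d : ℝ} (hθ : Continuous θ) (hm : Monotone θ)
    (hd : HasDerivAt (fun t => Real.sin (θ t - θ t₀)) d t₀) : 0 ≤ d := by
  have h1 : Tendsto (slope (fun t => Real.sin (θ t - θ t₀)) t₀) (𝓝[>] t₀) (𝓝 d) :=
    (hasDerivAt_iff_tendsto_slope.1 hd).mono_left
      (nhdsWithin_mono _ fun x (hx : t₀ < x) => hx.ne')
  have h2 : ∀ᶠ t in 𝓝[>] t₀, θ t - θ t₀ < Real.pi := by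
    have : Tendsto (fun t => θ t - θ t₀) (𝓝 t₀) (𝓝 0) := by
      have := (hθ.tendsto t₀).sub_const (θ t₀)
      rwa [sub_self] at this
    exact (this.eventually (gt_mem_nhds Real.pi_pos)).filter_mono nhdsWithin_le_nhds
  refine ge_of_tendsto h1 ?_
  filter_upwards [h2, self_mem_nhdsWithin] with t ht (ht0 : t₀ < t)
  have h3 : 0 ≤ θ t - θ t₀ := sub_nonneg.2 (hm ht0.le)
  rw [slope_def_field]
  simp only [sub_self, Real.sin_zero, sub_zero]
  exact div_nonneg (Real.sin_nonneg_of_nonneg_of_le_pi h3 ht.le) (by linarith)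

theorem nonpos_of_hasDerivAt_sin {θ : ℝ → ℝ} {t₀ d : ℝ} (hθ : Continuous θ) (hm : Antitone θ)
    (hd : HasDerivAt (fun t => Real.sin (θ t - θ t₀)) d t₀) : d ≤ 0 := by
  have h : HasDerivAt (fun t => Real.sin (-θ t - -θ t₀)) (-d) t₀ := by
    have : (fun t => Real.sin (-θ t - -θ t₀)) = -fun t => Real.sin (θ t - θ t₀) := by
      ext t
      rw [Pi.neg_apply, ← Real.sin_neg]
      congr 1
      ring
    rw [this]
    exact hd.neg
  have := nonneg_of_hasDerivAt_sin (θ := fun t => -θ t) hθ.neg hm.neg h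
  linarith

/-! ### The affine image of the unit circle -/

/-- The image of a complex number under the affine map from the unit circle to the ellipse. -/
def pt (a b : ℝ) (z : ℂ) : Plane := !₂[a * z.re, b * z.im]

/-- Half of the squared distance of two points of the unit circle. -/
def chord (u v : ℂ) : ℝ := 1 - (u * conj v).re

theorem mul_conj_of_norm {u : ℂ} (hu : ‖u‖ = 1) : u * conj u = 1 := by
  rw [Complex.mul_conj', hu]; norm_num

theorem re_sq_add_im_sq_of_norm {u : ℂ} (hu : ‖u‖ = 1) : u.re ^ 2 + u.im ^ 2 = 1 := by
  have := Complex.sq_norm u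
  rw [hu, Complex.normSq_apply] at this
  linarith

theorem ne_zero_of_norm {u : ℂ} (hu : ‖u‖ = 1) : u ≠ 0 := by
  rintro rfl; simp at hu

theorem chord_eq (u v : ℂ) : chord u v = 1 - (u.re * v.re + u.im * v.im) := by
  simp [chord, Complex.mul_re]

theorem chord_comm (u v : ℂ) : chord u v = chord v u := by
  simp only [chord_eq]; ring

theorem ofReal_chord (u v : ℂ) : (chord u v : ℂ) = (2 - u * conj v - v * conj u) / 2 := by
  have h : conj (u * conj v) = v * conj u := by simp [mul_comm]
  have := Complex.add_conj (u * conj v)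
  rw [h] at this
  rw [chord, Complex.ofReal_sub, Complex.ofReal_one]
  push_cast at this
  linear_combination (1 / 2) * this

theorem chord_pos {u v : ℂ} (hu : ‖u‖ = 1) (hv : ‖v‖ = 1) (h : u ≠ v) : 0 < chord u v := by
  have h1 := re_sq_add_im_sq_of_norm hu
  have h2 := re_sq_add_im_sq_of_norm hv
  have h3 : 0 < (u.re - v.re) ^ 2 + (u.im - v.im) ^ 2 := by
    by_contra hc
    apply h
    apply Complex.ext <;> nlinarith [sq_nonneg (u.re - v.re), sq_nonneg (u.im - v.im)]
  rw [chord_eq]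
  nlinarith

section
variable {a b : ℝ}

theorem point_eq_pt (t : ℝ) : point a b t = pt a b (Complex.exp (t * Complex.I)) := by
  simp [point, pt, Complex.exp_ofReal_mul_I_re, Complex.exp_ofReal_mul_I_im]

theorem pt_injective (ha : a ≠ 0) (hb : b ≠ 0) : Function.Injective (pt a b) := by
  intro u v h
  have h0 := congrArg (fun P : Plane => P 0) h
  have h1 := congrArg (fun P : Plane => P 1) h
  simp only [pt, PiLp.toLp_apply, Matrix.cons_val_zero, Matrix.cons_val_one] at h0 h1
  exact Complex.ext (mul_left_cancel₀ ha h0) (mul_left_cancel₀ hb h1)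

theorem pt_mem_boundary (ha : a ≠ 0) (hb : b ≠ 0) {u : ℂ} (hu : ‖u‖ = 1) :
    pt a b u ∈ boundary a b := by
  have := re_sq_add_im_sq_of_norm hu
  simp only [boundary, pt, Set.mem_ofPred_eq, Matrix.cons_val_zero,
    Matrix.cons_val_one]
  rwa [mul_div_cancel_left₀ _ ha, mul_div_cancel_left₀ _ hb]

theorem exists_pt_of_mem_boundary (ha : a ≠ 0) (hb : b ≠ 0) {P : Plane} (hP : P ∈ boundary a b) :
    ∃ u : ℂ, ‖u‖ = 1 ∧ P = pt a b u := by
  refine ⟨⟨P 0 / a, P 1 / b⟩, ?_, ?_⟩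
  · have h : (P 0 / a) ^ 2 + (P 1 / b) ^ 2 = 1 := hP
    rw [← sq_eq_sq₀ (norm_nonneg _) zero_le_one, Complex.sq_norm, Complex.normSq_mk]
    linarith
  · ext i
    fin_cases i <;> simp [pt] <;> field_simp

theorem dist_pt_sq {u v : ℂ} (hu : ‖u‖ = 1) (hv : ‖v‖ = 1) :
    dist (pt a b u) (pt a b v) ^ 2 =
      chord u v * ((a ^ 2 + b ^ 2) - (a ^ 2 - b ^ 2) * (u * v).re) := by
  have h1 := re_sq_add_im_sq_of_norm hu
  have h2 := re_sq_add_im_sq_of_norm hv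
  rw [EuclideanSpace.dist_eq, Real.sq_sqrt (by positivity), Fin.sum_univ_two, chord_eq,
    Complex.mul_re, Real.dist_eq, Real.dist_eq, sq_abs, sq_abs]
  simp only [pt, PiLp.toLp_apply, Matrix.cons_val_zero, Matrix.cons_val_one]
  linear_combination (a ^ 2 * v.im ^ 2 + b ^ 2 * v.re ^ 2) * h1 +
    (a ^ 2 * (1 - u.re ^ 2) + b ^ 2 * (1 - u.im ^ 2)) * h2

theorem inner_normal (ha : a ≠ 0) (hb : b ≠ 0) {u : ℂ} (hu : ‖u‖ = 1) (v : ℂ) :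
    inner ℝ (pt a b v - pt a b u) (normal a b (pt a b u)) = -chord v u := by
  have h1 := re_sq_add_im_sq_of_norm hu
  rw [chord_eq, PiLp.inner_apply, Fin.sum_univ_two]
  simp only [pt, normal, PiLp.toLp_apply, PiLp.sub_apply, Matrix.cons_val_zero,
    Matrix.cons_val_one, RCLike.inner_apply, conj_trivial]
  field_simp
  linear_combination -h1

theorem normal_ne_zero (ha : a ≠ 0) (hb : b ≠ 0) {u : ℂ} (hu : ‖u‖ = 1) :
    normal a b (pt a b u) ≠ 0 := by
  have h1 := re_sq_add_im_sq_of_norm hu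
  intro h
  have h0 := congrArg (fun P : Plane => P 0) h
  have h1 := congrArg (fun P : Plane => P 1) h
  simp only [pt, normal, PiLp.toLp_apply, Matrix.cons_val_zero, Matrix.cons_val_one,
    PiLp.zero_apply] at h0 h1
  have h2 : u.re = 0 := by field_simp at h0; simpa [ha] using h0
  have h3 : u.im = 0 := by field_simp at h1; simpa [hb] using h1
  simp_all

/-- The law of reflection compares the cosines of the two angles. -/
theorem reflects_pt_iff (ha : a ≠ 0) (hb : b ≠ 0) {u : ℂ} (hu : ‖u‖ = 1) (v w : ℂ) :
    Reflects a b (pt a b v) (pt a b u) (pt a b w) ↔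
      chord v u / dist (pt a b v) (pt a b u) = chord w u / dist (pt a b w) (pt a b u) := by
  have hn : ‖normal a b (pt a b u)‖ ≠ 0 := norm_ne_zero_iff.2 (normal_ne_zero ha hb hu)
  have key : ∀ w : ℂ, inner ℝ (pt a b w - pt a b u) (normal a b (pt a b u)) /
      (‖pt a b w - pt a b u‖ * ‖normal a b (pt a b u)‖) =
      -(chord w u / dist (pt a b w) (pt a b u)) / ‖normal a b (pt a b u)‖ := by
    intro w
    rw [inner_normal ha hb hu, dist_eq_norm, ← neg_div, div_div]
  have h : Reflects a b (pt a b v) (pt a b u) (pt a b w) ↔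
      Real.cos (InnerProductGeometry.angle (pt a b v - pt a b u) (normal a b (pt a b u))) =
      Real.cos (InnerProductGeometry.angle (pt a b w - pt a b u) (normal a b (pt a b u))) :=
    ⟨fun h => congrArg Real.cos h, fun h => Real.injOn_cos
      ⟨InnerProductGeometry.angle_nonneg _ _, InnerProductGeometry.angle_le_pi _ _⟩
      ⟨InnerProductGeometry.angle_nonneg _ _, InnerProductGeometry.angle_le_pi _ _⟩ h⟩
  rw [h, InnerProductGeometry.cos_angle, InnerProductGeometry.cos_angle, key, key, div_left_inj' hn,
    neg_inj]

end

/-! ### Triangles in the unit circle with constant `z₁z₂ + z₂z₃ + z₃z₁` -/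

/-- A triple of points of the unit circle with `z₁z₂ + z₂z₃ + z₃z₁ = -g`. -/
structure IsTriple (g : ℝ) (u v w : ℂ) : Prop where
  norm₁ : ‖u‖ = 1
  norm₂ : ‖v‖ = 1
  norm₃ : ‖w‖ = 1
  eq : u * v + v * w + w * u = -g

namespace IsTriple
variable {g : ℝ} {u v w : ℂ}

theorem rotate (h : IsTriple g u v w) : IsTriple g v w u :=
  ⟨h.norm₂, h.norm₃, h.norm₁, by linear_combination h.eq⟩

theorem swap (h : IsTriple g u v w) : IsTriple g u w v :=
  ⟨h.norm₁, h.norm₃, h.norm₂, by linear_combination h.eq⟩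

/-- Conjugation inverts points of the unit circle: conjugate the defining equation and multiply by
`uvw`. -/
theorem sum_eq (h : IsTriple g u v w) : u + v + w = -g * (u * v * w) := by
  have hu := mul_conj_of_norm h.norm₁
  have hv := mul_conj_of_norm h.norm₂
  have hw := mul_conj_of_norm h.norm₃
  have hc : conj u * conj v + conj v * conj w + conj w * conj u = -g := by
    simpa using congrArg conj h.eq
  generalize conj u = u' at *
  generalize conj v = v' at *
  generalize conj w = w' at *
  linear_combination (u * v * w) * hc - (v * v' * w + w * w' * v) * hu
    - (w + w * w' * u) * hv - (v + u) * hw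

/-- If `u = v`, then `2uw = -g - u²`, where the left side has norm 2 and the right side at most `|g|
+ 1`. -/
theorem ne (h : IsTriple g u v w) (hg : |g| < 1) : u ≠ v := by
  rintro rfl
  have h1 : u * u + 2 * u * w = -g := by linear_combination h.eq
  have h2 : ‖2 * u * w‖ = 2 := by simp [h.norm₁, h.norm₃]
  have h3 : 2 * u * w = -g - u * u := by linear_combination h1
  have h4 : ‖(-g : ℂ) - u * u‖ ≤ |g| + 1 := by
    refine (norm_sub_le _ _).trans ?_
    simp [h.norm₁]
  rw [← h3, h2] at h4
  linarith

theorem prod_eq (h : IsTriple g u v w) : v * w * (1 - g * u ^ 2) = u ^ 2 - g := by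
  linear_combination h.eq - u * h.sum_eq

/-- Two triples with the same first point have the same other points, up to order. -/
theorem eq_or_eq (h : IsTriple g u v w) (hg : |g| < 1) {v' w' : ℂ} (h' : IsTriple g u v' w') :
    v' = v ∧ w' = w ∨ v' = w ∧ w' = v := by
  have hne : (1 : ℂ) - g * u ^ 2 ≠ 0 := by
    intro h0
    have : ‖(g : ℂ) * u ^ 2‖ = 1 := by
      rw [← sub_eq_zero.1 h0, norm_one]
    rw [norm_mul, norm_pow, h.norm₁, Complex.norm_real, Real.norm_eq_abs] at this
    linarith
  have hp : v' * w' = v * w := mul_right_cancel₀ hne (h'.prod_eq.trans h.prod_eq.symm)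
  have hs : v' + w' = v + w := by
    linear_combination h'.sum_eq - h.sum_eq - g * u * hp
  have hz : (v' - v) * (v' - w) = 0 := by linear_combination v' * hs - hp
  rcases mul_eq_zero.1 hz with h0 | h0
  · left
    exact ⟨sub_eq_zero.1 h0, by linear_combination hs - h0⟩
  · right
    exact ⟨sub_eq_zero.1 h0, by linear_combination hs - h0⟩

theorem biquadratic (h : IsTriple g u v w) :
    g * (u ^ 2 * v ^ 2 + 1) - u ^ 2 - v ^ 2 + (g ^ 2 - 1) * u * v = 0 := by
  linear_combination (1 + g * u * v) * h.eq - (u + v) * h.sum_eq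

/-- The three chords are not all equal. -/
theorem not_equilateral (h : IsTriple g u v w) (hg : |g| < 1) (hg0 : g ≠ 0)
    (h₁ : chord u v = chord v w) (h₂ : chord v w = chord w u) : False := by
  -- An isosceles triangle is symmetric about the diameter through its apex. Two such symmetries
  -- force `u + v + w = 0`, against `sum_eq`.
  have key : ∀ {u v w : ℂ}, IsTriple g u v w → chord u v = chord w u → v * w = u ^ 2 := by
    intro u v w h h12
    have h1 : (chord u v : ℂ) = chord w u := by rw [h12]
    rw [ofReal_chord, ofReal_chord] at h1
    have hu := mul_conj_of_norm h.norm₁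
    have hv := mul_conj_of_norm h.norm₂
    have hw := mul_conj_of_norm h.norm₃
    have hvw : v - w ≠ 0 := sub_ne_zero.2 (h.rotate.ne hg)
    generalize conj u = u' at *
    generalize conj v = v' at *
    generalize conj w = w' at *
    apply mul_left_cancel₀ hvw
    linear_combination (-2 * u * v * w) * h1 + (w * v * (w - v)) * hu
      - u ^ 2 * w * hv + u ^ 2 * v * hw
  have h1 := key h (h₁.trans h₂)
  have h2 := key h.rotate h₁.symm
  have h3 : (u - v) * (u + v + w) = 0 := by linear_combination h2 - h1
  have h4 : u + v + w = 0 := (mul_eq_zero.1 h3).resolve_left (sub_ne_zero.2 (h.ne hg))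
  have h5 := h.sum_eq
  rw [h4] at h5
  have := ne_zero_of_norm h.norm₁
  have := ne_zero_of_norm h.norm₂
  have := ne_zero_of_norm h.norm₃
  simp_all

end IsTriple

/-- By `dist_pt_sq`, with `S = a² + b²` and `c = a² - b²`, the left side says that `chord² = J *
dist²` for distinct points. Multiplying by `2uv` removes the conjugates. -/
theorem chord_eq_iff {u v : ℂ} (hu : ‖u‖ = 1) (hv : ‖v‖ = 1) (J S c : ℝ) :
    chord u v = J * (S - c * (u * v).re) ↔
      (c * J : ℂ) * (u ^ 2 * v ^ 2 + 1) - u ^ 2 - v ^ 2 + 2 * (1 - J * S) * u * v = 0 := by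
  rw [← Complex.ofReal_inj]
  push_cast
  have hre : ((u * v).re : ℂ) = (u * v + conj u * conj v) / 2 := by
    have := Complex.add_conj (u * v)
    rw [map_mul] at this
    rw [this]; push_cast; ring
  rw [ofReal_chord, hre, ← sub_eq_zero]
  have hu' := mul_conj_of_norm hu
  have hv' := mul_conj_of_norm hv
  have h2 : 2 * u * v ≠ 0 := by simp [ne_zero_of_norm hu, ne_zero_of_norm hv]
  rw [← mul_eq_zero_iff_left h2 (b := (2 - u * conj v - v * conj u) / 2 - _)]
  generalize conj u = u' at *
  generalize conj v = v' at *
  have : ∀ x y : ℂ, x = y → (x = 0 ↔ y = 0) := fun x y h => by rw [h]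
  apply this
  linear_combination (-v ^ 2 + J * c * v * v') * hu' + (-u ^ 2 + J * c) * hv'

/-- For fixed `u`, the points `v` and `w` are the two roots of one quadratic. Differences of the
relations can be divided by differences of the points, which gives Vieta's formulas. The
compatibility `k² = 2m + 1` becomes the equation for `g`. -/
theorem triple_of_biquadratic {k m u v w : ℂ} (huv : u ≠ v) (hvw : v ≠ w) (hwu : w ≠ u)
    (h₁ : k * (u ^ 2 * v ^ 2 + 1) - u ^ 2 - v ^ 2 + 2 * m * u * v = 0)
    (h₂ : k * (v ^ 2 * w ^ 2 + 1) - v ^ 2 - w ^ 2 + 2 * m * v * w = 0)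
    (h₃ : k * (w ^ 2 * u ^ 2 + 1) - w ^ 2 - u ^ 2 + 2 * m * w * u = 0) :
    u * v + v * w + w * u = -k ∧ k ^ 2 = 2 * m + 1 := by
  have e1 : (k * u ^ 2 - 1) * (v + w) = -2 * m * u := by
    apply mul_left_cancel₀ (sub_ne_zero.2 hvw)
    linear_combination h₁ - h₃
  have e2 : (k * v ^ 2 - 1) * (w + u) = -2 * m * v := by
    apply mul_left_cancel₀ (sub_ne_zero.2 hwu)
    linear_combination h₂ - h₁
  have e3 : k * (u * v + v * w + w * u) = -(2 * m + 1) := by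
    apply mul_left_cancel₀ (sub_ne_zero.2 huv)
    linear_combination e1 - e2
  have m1 : v * w - k * u ^ 2 * v * w = u ^ 2 - k := by
    linear_combination h₁ - v * e1
  have m2 : w * u - k * v ^ 2 * w * u = v ^ 2 - k := by
    linear_combination h₂ - w * e2
  have e4 : u + v + w = -k * (u * v * w) := by
    apply mul_left_cancel₀ (sub_ne_zero.2 huv)
    linear_combination m2 - m1
  have e5 : u * v + v * w + w * u = -k := by linear_combination m1 + u * e4
  exact ⟨e5, by linear_combination k * e5 - e3⟩

/-! ### Billiard trajectories -/

section
variable {a b g : ℝ} {u v w : ℂ}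

/-- The biquadratic relation of the triple is the one of `chord_eq_iff` with `J = g / (a² - b²)`;
the coefficients match by the invariant equation. The factor does not depend on the side, so chords
can replace side lengths in the homogeneous weights of the center. -/
theorem IsTriple.chord_eq_mul_dist (h : IsTriple g u v w) (hb : 0 < b) (hab : b < a)
    (hg : IsInvariant a b g) :
    chord u v = √(g / (a ^ 2 - b ^ 2)) * dist (pt a b u) (pt a b v) := by
  have hc : 0 < a ^ 2 - b ^ 2 := sub_pos.2 (by gcongr)
  have hg1 : |g| < 1 := by rw [abs_of_pos hg.pos]; exact hg.lt_one
  have hp := chord_pos h.norm₁ h.norm₂ (h.ne hg1)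
  have h1 : (a ^ 2 - b ^ 2) * (g / (a ^ 2 - b ^ 2)) = g := mul_div_cancel₀ g hc.ne'
  have h2 : 2 * (1 - g / (a ^ 2 - b ^ 2) * (a ^ 2 + b ^ 2)) = g ^ 2 - 1 := by
    field_simp
    linear_combination hg.eq
  have h3 : chord u v = g / (a ^ 2 - b ^ 2) *
      ((a ^ 2 + b ^ 2) - (a ^ 2 - b ^ 2) * (u * v).re) := by
    rw [chord_eq_iff h.norm₁ h.norm₂]
    rw [← Complex.ofReal_inj] at h1 h2
    push_cast at h1 h2 ⊢
    rw [h1, h2]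
    exact h.biquadratic
  have h4 : chord u v ^ 2 = g / (a ^ 2 - b ^ 2) * dist (pt a b u) (pt a b v) ^ 2 := by
    rw [dist_pt_sq h.norm₁ h.norm₂]
    linear_combination chord u v * h3
  rw [← Real.sqrt_sq hp.le, h4, Real.sqrt_mul (div_pos hg.pos hc).le, Real.sqrt_sq dist_nonneg]

/-- Billiard triangles are the images of the triples in the unit circle with constant
`z₁z₂ + z₂z₃ + z₃z₁ = -g`. -/
theorem isThreePeriodic_pt_iff (hb : 0 < b) (hab : b < a) (hg : IsInvariant a b g)
    (hu : ‖u‖ = 1) (hv : ‖v‖ = 1) (hw : ‖w‖ = 1) :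
    IsThreePeriodic a b (pt a b u) (pt a b v) (pt a b w) ↔ IsTriple g u v w := by
  have ha : a ≠ 0 := (hb.trans hab).ne'
  have hb' : b ≠ 0 := hb.ne'
  have hc : 0 < a ^ 2 - b ^ 2 := sub_pos.2 (by gcongr)
  constructor
  · intro h
    have huv : u ≠ v := fun e => h.ne₁₂ (congrArg _ e)
    have hvw : v ≠ w := fun e => h.ne₂₃ (congrArg _ e)
    have hwu : w ≠ u := fun e => h.ne₃₁ (congrArg _ e)
    have r1 := (reflects_pt_iff ha hb' hu w v).1 h.reflects₁
    have r2 := (reflects_pt_iff ha hb' hv u w).1 h.reflects₂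
    rw [chord_comm v u, dist_comm (pt a b v)] at r1
    rw [chord_comm w v, dist_comm (pt a b w)] at r2
    set j := chord u v / dist (pt a b u) (pt a b v) with hj
    have key : ∀ {x y : ℂ}, ‖x‖ = 1 → ‖y‖ = 1 → x ≠ y →
        chord x y / dist (pt a b x) (pt a b y) = j →
        chord x y = j ^ 2 * ((a ^ 2 + b ^ 2) - (a ^ 2 - b ^ 2) * (x * y).re) := by
      intro x y hx hy hxy hq
      have hp := chord_pos hx hy hxy
      have hd : dist (pt a b x) (pt a b y) ≠ 0 :=
        dist_ne_zero.2 fun e => hxy (pt_injective ha hb' e)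
      have hs := dist_pt_sq (a := a) (b := b) hx hy
      rw [div_eq_iff hd] at hq
      apply mul_left_cancel₀ hp.ne'
      linear_combination (chord x y + j * dist (pt a b x) (pt a b y)) * hq + j ^ 2 * hs
    have k1 := (chord_eq_iff hu hv _ _ _).1 (key hu hv huv rfl)
    have k2 := (chord_eq_iff hv hw _ _ _).1 (key hv hw hvw r2.symm)
    have k3 := (chord_eq_iff hw hu _ _ _).1 (key hw hu hwu r1)
    obtain ⟨e1, e2⟩ := triple_of_biquadratic huv hvw hwu k1 k2 k3
    have hj0 : 0 < j := div_pos (chord_pos hu hv huv)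
      (dist_pos.2 fun e => huv (pt_injective ha hb' e))
    have hk : (a ^ 2 - b ^ 2) * j ^ 2 = g := by
      apply hg.unique hb hab (by positivity)
      have : ((a ^ 2 - b ^ 2) * j ^ 2) ^ 2 = 2 * (1 - j ^ 2 * (a ^ 2 + b ^ 2)) + 1 := by
        exact_mod_cast e2
      linear_combination -(a ^ 2 - b ^ 2) * this
    refine ⟨hu, hv, hw, ?_⟩
    rw [e1, ← hk]
    push_cast
    ring
  · intro h
    have hg1 : |g| < 1 := by rw [abs_of_pos hg.pos]; exact hg.lt_one
    have hJ : 0 < √(g / (a ^ 2 - b ^ 2)) := Real.sqrt_pos.2 (div_pos hg.pos hc)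
    have refl : ∀ {u v w : ℂ}, IsTriple g u v w → Reflects a b (pt a b w) (pt a b u) (pt a b v) := by
      intro u v w h
      rw [reflects_pt_iff ha hb' h.norm₁, h.rotate.rotate.chord_eq_mul_dist hb hab hg,
        h.swap.rotate.rotate.chord_eq_mul_dist hb hab hg, mul_div_assoc, mul_div_assoc, div_self,
        div_self]
      · exact dist_ne_zero.2 fun e => h.ne hg1 (pt_injective ha hb' e).symm
      · exact dist_ne_zero.2 fun e => h.rotate.rotate.ne hg1 (pt_injective ha hb' e)
    exact ⟨pt_mem_boundary ha hb' hu, pt_mem_boundary ha hb' hv, pt_mem_boundary ha hb' hw,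
      fun e => h.ne hg1 (pt_injective ha hb' e),
      fun e => h.rotate.ne hg1 (pt_injective ha hb' e),
      fun e => h.rotate.rotate.ne hg1 (pt_injective ha hb' e),
      refl h, refl h.rotate, refl h.rotate.rotate⟩

end

/-! ### The center `X₁₆₂` in the complex plane -/

/-- The sum of the barycentric weights of `X₁₆₂` of a triangle with side lengths `s₁`, `s₂`, `s₃`. -/
def weightSum (s₁ s₂ s₃ : ℝ) : ℝ :=
  s₁ * (den162 s₂ s₃ s₁ * den162 s₃ s₁ s₂) + s₂ * (den162 s₃ s₁ s₂ * den162 s₁ s₂ s₃) +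
    s₃ * (den162 s₁ s₂ s₃ * den162 s₂ s₃ s₁)

/-- The point with the barycentric weights of `X₁₆₂` for the side lengths `s₁`, `s₂`, `s₃`
with respect to `z₁`, `z₂`, `z₃`. -/
def center (z₁ z₂ z₃ : ℂ) (s₁ s₂ s₃ : ℝ) : ℂ :=
  ((s₁ * (den162 s₂ s₃ s₁ * den162 s₃ s₁ s₂) : ℝ) * z₁ +
    (s₂ * (den162 s₃ s₁ s₂ * den162 s₁ s₂ s₃) : ℝ) * z₂ +
    (s₃ * (den162 s₁ s₂ s₃ * den162 s₂ s₃ s₁) : ℝ) * z₃) / (weightSum s₁ s₂ s₃ : ℝ)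

theorem X162_pt (a b : ℝ) (z₁ z₂ z₃ : ℂ) :
    X162 (pt a b z₁) (pt a b z₂) (pt a b z₃) = pt a b (center z₁ z₂ z₃
      (dist (pt a b z₂) (pt a b z₃)) (dist (pt a b z₃) (pt a b z₁))
      (dist (pt a b z₁) (pt a b z₂))) := by
  ext i
  fin_cases i <;>
  · simp only [X162, ofTrilinears, center, weightSum, pt, Complex.div_ofReal_re,
      Complex.div_ofReal_im, Complex.add_re, Complex.add_im, Complex.re_ofReal_mul,
      Complex.im_ofReal_mul, PiLp.smul_apply, PiLp.add_apply, smul_eq_mul, Fin.zero_eta,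
      Fin.mk_one, Matrix.cons_val_zero, Matrix.cons_val_one]
    ring

theorem den162_mul (c s₁ s₂ s₃ : ℝ) : den162 (c * s₁) (c * s₂) (c * s₃) = c ^ 4 * den162 s₁ s₂ s₃ := by
  unfold den162; ring

theorem center_mul {c : ℝ} (hc : c ≠ 0) (z₁ z₂ z₃ : ℂ) (s₁ s₂ s₃ : ℝ) :
    center z₁ z₂ z₃ (c * s₁) (c * s₂) (c * s₃) = center z₁ z₂ z₃ s₁ s₂ s₃ := by
  -- Each weight is a side times two denominators of degree 4, hence homogeneous of degree 9.
  have hc' : (c : ℂ) ^ 9 ≠ 0 := pow_ne_zero _ (Complex.ofReal_ne_zero.2 hc)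
  unfold center weightSum
  simp only [den162_mul]
  refine Eq.trans ?_ (mul_div_mul_left _ _ hc')
  congr 1 <;> (push_cast; ring)

theorem den162_swap (s₁ s₂ s₃ : ℝ) : den162 s₁ s₃ s₂ = -den162 s₁ s₂ s₃ := by
  unfold den162; ring

theorem center_swap (z₁ z₂ z₃ : ℂ) (s₁ s₂ s₃ : ℝ) :
    center z₁ z₃ z₂ s₁ s₃ s₂ = center z₁ z₂ z₃ s₁ s₂ s₃ := by
  unfold center weightSum
  rw [den162_swap s₁ s₂ s₃, den162_swap s₂ s₃ s₁, den162_swap s₃ s₁ s₂]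
  congr 1 <;> (push_cast; ring)

theorem den162_add (s₁ s₂ s₃ : ℝ) : den162 s₁ s₂ s₃ + den162 s₂ s₃ s₁ + den162 s₃ s₁ s₂ = 0 := by
  unfold den162; ring

/-- The weights of `X₁₆₂` do not add up to zero: this is where the triangle inequality enters. -/
theorem weightSum_ne_zero {s₁ s₂ s₃ : ℝ} (h₁ : 0 < s₁) (h₂ : 0 < s₂) (h₃ : 0 < s₃)
    (t₁ : s₁ ≤ s₂ + s₃) (t₂ : s₂ ≤ s₃ + s₁) (t₃ : s₃ ≤ s₁ + s₂)
    (hne : ¬ (s₁ = s₂ ∧ s₂ = s₃)) : weightSum s₁ s₂ s₃ ≠ 0 := by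
  have hadd := den162_add s₁ s₂ s₃
  have hpq : ¬ (den162 s₁ s₂ s₃ = 0 ∧ den162 s₂ s₃ s₁ = 0) := by
    rintro ⟨hp, hq⟩
    rw [hp, hq] at hadd
    have hr : den162 s₃ s₁ s₂ = 0 := by linarith
    have sq_eq : ∀ {x y : ℝ}, 0 < x → 0 < y → x ^ 2 - y ^ 2 = 0 → x = y := fun hx hy h =>
      (sq_eq_sq₀ hx.le hy.le).1 (sub_eq_zero.1 h)
    have q₁ : 0 < s₁ ^ 2 := by positivity
    have q₂ : 0 < s₂ ^ 2 := by positivity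
    have q₃ : 0 < s₃ ^ 2 := by positivity
    rcases mul_eq_zero.1 hp with hp | hp <;> rcases mul_eq_zero.1 hq with hq | hq <;>
      rcases mul_eq_zero.1 hr with hr | hr
    · exact hne ⟨sq_eq h₁ h₂ hr, sq_eq h₂ h₃ hp⟩
    all_goals exact hne ⟨sq_eq h₁ h₂ (by linarith), sq_eq h₂ h₃ (by linarith)⟩
  -- Eliminating `r = -p - q` turns the weight sum into minus the quadratic form `s₂p² + (s₁ + s₂ -
  -- s₃)pq + s₁q²`. Its discriminant condition is positivity of the sum of the pairwise products of
  -- `s₂ + s₃ - s₁`, `s₃ + s₁ - s₂`, `s₁ + s₂ - s₃`.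
  have hdisc : 0 < 4 * s₁ * s₂ - (s₁ + s₂ - s₃) ^ 2 := by
    have i₁ : 0 ≤ (s₂ + s₃ - s₁) * (s₃ + s₁ - s₂) := mul_nonneg (by linarith) (by linarith)
    have i₂ : 0 ≤ (s₃ + s₁ - s₂) * (s₁ + s₂ - s₃) := mul_nonneg (by linarith) (by linarith)
    have i₃ : 0 ≤ (s₁ + s₂ - s₃) * (s₂ + s₃ - s₁) := mul_nonneg (by linarith) (by linarith)
    by_contra hc
    have j : ∀ {x y : ℝ}, x * y = 0 → x = 0 ∨ y = 0 := fun h => mul_eq_zero.1 h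
    rcases j (show (s₂ + s₃ - s₁) * (s₃ + s₁ - s₂) = 0 by nlinarith) with j₁ | j₁ <;>
      rcases j (show (s₃ + s₁ - s₂) * (s₁ + s₂ - s₃) = 0 by nlinarith) with j₂ | j₂ <;>
      rcases j (show (s₁ + s₂ - s₃) * (s₂ + s₃ - s₁) = 0 by nlinarith) with j₃ | j₃ <;>
      linarith
  intro h0
  have hr : den162 s₃ s₁ s₂ = -den162 s₁ s₂ s₃ - den162 s₂ s₃ s₁ := by linarith
  unfold weightSum at h0
  rw [hr] at h0
  generalize den162 s₁ s₂ s₃ = p at *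
  generalize den162 s₂ s₃ s₁ = q at *
  have e1 : (2 * s₂ * p + (s₁ + s₂ - s₃) * q) ^ 2 +
      (4 * s₁ * s₂ - (s₁ + s₂ - s₃) ^ 2) * q ^ 2 = 0 := by
    linear_combination -4 * s₂ * h0
  have hq : q = 0 := by
    by_contra hq
    have : 0 < q ^ 2 := by positivity
    nlinarith [sq_nonneg (2 * s₂ * p + (s₁ + s₂ - s₃) * q), mul_pos hdisc this]
  subst hq
  have hp : (2 * s₂ * p) ^ 2 = 0 := by linear_combination e1
  have hp' : p = 0 := by simpa [h₂.ne'] using hp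
  exact hpq ⟨hp', rfl⟩

/-- On the unit circle, with the chords as side lengths, the center is again on the unit circle. -/
theorem norm_center {u v w : ℂ} (hu : ‖u‖ = 1) (hv : ‖v‖ = 1) (hw : ‖w‖ = 1)
    (h : weightSum (chord v w) (chord w u) (chord u v) ≠ 0) :
    ‖center u v w (chord v w) (chord w u) (chord u v)‖ = 1 := by
  have hr := den162_add (chord v w) (chord w u) (chord u v)
  have e1 := chord_eq v w
  have e2 := chord_eq w u
  have e3 := chord_eq u v
  have hu := re_sq_add_im_sq_of_norm hu
  have hv := re_sq_add_im_sq_of_norm hv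
  have hw := re_sq_add_im_sq_of_norm hw
  unfold center
  rw [norm_div, Complex.norm_real, Real.norm_eq_abs, div_eq_one_iff_eq (abs_ne_zero.2 h),
    ← abs_norm, ← sq_eq_sq_iff_abs_eq_abs, Complex.sq_norm, Complex.normSq_apply]
  unfold weightSum
  simp only [Complex.add_re, Complex.add_im, Complex.re_ofReal_mul, Complex.im_ofReal_mul]
  generalize chord v w = s₁ at *
  generalize chord w u = s₂ at *
  generalize chord u v = s₃ at *
  generalize den162 s₁ s₂ s₃ = p at *
  generalize den162 s₂ s₃ s₁ = q at *
  generalize den162 s₃ s₁ s₂ = r at *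
  -- For weights `wᵢ`, `|Σ wᵢzᵢ|² = (Σ wᵢ)² - 2 Σ wᵢwⱼ chord zᵢ zⱼ`. Here the last sum equals
  -- `s₁s₂s₃ pqr (p + q + r) = 0`.
  linear_combination (s₁ * (q * r)) ^ 2 * hu + (s₂ * (r * p)) ^ 2 * hv + (s₃ * (p * q)) ^ 2 * hw
    + 2 * (s₁ * (q * r)) * (s₂ * (r * p)) * e3 + 2 * (s₂ * (r * p)) * (s₃ * (p * q)) * e1
    + 2 * (s₃ * (p * q)) * (s₁ * (q * r)) * e2 - 2 * s₁ * s₂ * s₃ * p * q * r * hr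

/-! ### The explicit family of triples -/

/-- The absolute value of `1 - g z²` for `z = exp (i t)`. -/
def radius (g t : ℝ) : ℝ := √(1 - 2 * g * Real.cos (2 * t) + g ^ 2)

/-- The direction of the perpendicular bisector of the side opposite to `exp (i t)`. -/
def axis (g t : ℝ) : ℂ :=
  ⟨(1 - g) * Real.cos t / radius g t, (1 + g) * Real.sin t / radius g t⟩

/-- The signed distance of the origin from the side opposite to `exp (i t)`. -/
def offset (g t : ℝ) : ℝ := (1 - g ^ 2) / (2 * radius g t)

/-- Half of the length of the side opposite to `exp (i t)`. -/
def halfSide (g t : ℝ) : ℝ := √(1 - offset g t ^ 2)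

/-- The first vertex `exp (i t)` of the triple with parameter `t`. -/
def vertex₁ (t : ℝ) : ℂ := ⟨Real.cos t, Real.sin t⟩

/-- The second vertex of the triple with parameter `t`. -/
def vertex₂ (g t : ℝ) : ℂ := axis g t * ⟨-offset g t, halfSide g t⟩

/-- The third vertex of the triple with parameter `t`. -/
def vertex₃ (g t : ℝ) : ℂ := axis g t * ⟨-offset g t, -halfSide g t⟩

/-- The length of the side opposite to the first vertex, up to a constant factor. -/
def side₁ (g t : ℝ) : ℝ := chord (vertex₂ g t) (vertex₃ g t)

/-- The length of the side opposite to the second vertex, up to a constant factor. -/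
def side₂ (g t : ℝ) : ℝ := chord (vertex₃ g t) (vertex₁ t)

/-- The length of the side opposite to the third vertex, up to a constant factor. -/
def side₃ (g t : ℝ) : ℝ := chord (vertex₁ t) (vertex₂ g t)

/-- The motion of `X₁₆₂`, transported to the unit circle. -/
def centerMotion (g t : ℝ) : ℂ :=
  center (vertex₁ t) (vertex₂ g t) (vertex₃ g t) (side₁ g t) (side₂ g t) (side₃ g t)

theorem vertex₁_eq_exp (t : ℝ) : vertex₁ t = Complex.exp (t * Complex.I) :=
  Complex.ext (Complex.exp_ofReal_mul_I_re t).symm (Complex.exp_ofReal_mul_I_im t).symm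

theorem norm_vertex₁ (t : ℝ) : ‖vertex₁ t‖ = 1 := by
  rw [vertex₁_eq_exp, Complex.norm_exp_ofReal_mul_I]

theorem one_sub_abs_sq_le (g t : ℝ) :
    (1 - |g|) ^ 2 ≤ 1 - 2 * g * Real.cos (2 * t) + g ^ 2 := by
  have h1 : g * Real.cos (2 * t) ≤ |g| := by
    refine (le_abs_self _).trans ?_
    rw [abs_mul]
    exact mul_le_of_le_one_right (abs_nonneg g) (Real.abs_cos_le_one _)
  nlinarith [sq_abs g]

theorem one_sub_abs_le_radius (g t : ℝ) : 1 - |g| ≤ radius g t :=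
  Real.le_sqrt_of_sq_le (one_sub_abs_sq_le g t)

theorem radius_sq (g t : ℝ) : radius g t ^ 2 = 1 - 2 * g * Real.cos (2 * t) + g ^ 2 :=
  Real.sq_sqrt ((sq_nonneg _).trans (one_sub_abs_sq_le g t))

section
variable {g : ℝ}

theorem radius_pos (hg : |g| < 1) (t : ℝ) : 0 < radius g t :=
  (sub_pos.2 hg).trans_le (one_sub_abs_le_radius g t)

theorem offset_sq_lt_one (hg : |g| < 1) (t : ℝ) : offset g t ^ 2 < 1 := by
  have h1 := one_sub_abs_le_radius g t
  have h2 := radius_pos hg t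
  have h3 : g ^ 2 < 1 := (sq_lt_one_iff_abs_lt_one g).2 hg
  have h4 : 0 ≤ offset g t := div_nonneg (by linarith) (by linarith)
  have h5 : offset g t < 1 := by
    rw [offset, div_lt_one (by linarith)]
    nlinarith [sq_abs g, abs_nonneg g]
  nlinarith

theorem halfSide_sq (hg : |g| < 1) (t : ℝ) : halfSide g t ^ 2 = 1 - offset g t ^ 2 :=
  Real.sq_sqrt (sub_nonneg.2 (offset_sq_lt_one hg t).le)

theorem norm_eq_one_of_re_im {z : ℂ} (h : z.re ^ 2 + z.im ^ 2 = 1) : ‖z‖ = 1 := by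
  rw [← sq_eq_sq₀ (norm_nonneg _) zero_le_one, Complex.sq_norm, Complex.normSq_apply]
  linarith

theorem norm_axis (hg : |g| < 1) (t : ℝ) : ‖axis g t‖ = 1 := by
  have h1 := radius_pos hg t
  have h2 := radius_sq g t
  have h3 := Real.sin_sq_add_cos_sq t
  rw [Real.cos_two_mul] at h2
  apply norm_eq_one_of_re_im
  simp only [axis]
  field_simp
  linear_combination (1 + g) ^ 2 * h3 - h2

/-- With `u = exp (i t)`, the square of `axis` is `(u² - g)/(1 - gu²)`, the product required by
`prod_eq`, and `-offset * axis` is the midpoint of the opposite side. Allowing either sign of `g` is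
what later permits the quarter turn. -/
theorem isTriple_vertex (hg : |g| < 1) (t : ℝ) :
    IsTriple g (vertex₁ t) (vertex₂ g t) (vertex₃ g t) := by
  have hs := halfSide_sq hg t
  have hN := radius_pos hg t
  have hN2 := radius_sq g t
  rw [Real.cos_two_mul] at hN2
  have hcs := Real.sin_sq_add_cos_sq t
  refine ⟨norm_vertex₁ t, ?_, ?_, ?_⟩
  · rw [vertex₂, norm_mul, norm_axis hg, one_mul]
    exact norm_eq_one_of_re_im (by simp only; linarith)
  · rw [vertex₃, norm_mul, norm_axis hg, one_mul]
    exact norm_eq_one_of_re_im (by simp only; linarith)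
  · have h1 : vertex₂ g t + vertex₃ g t = (-2 * offset g t : ℝ) * axis g t := by
      apply Complex.ext <;>
      · simp only [vertex₂, vertex₃, Complex.add_re, Complex.add_im, Complex.mul_re,
          Complex.mul_im, Complex.ofReal_re, Complex.ofReal_im]
        ring
    have h2 : vertex₂ g t * vertex₃ g t = axis g t ^ 2 := by
      have : (⟨-offset g t, halfSide g t⟩ : ℂ) * ⟨-offset g t, -halfSide g t⟩ = 1 := by
        apply Complex.ext
        · simp only [Complex.mul_re, Complex.one_re]; linarith
        · simp only [Complex.mul_im, Complex.one_im]; ring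
      rw [vertex₂, vertex₃]
      linear_combination axis g t ^ 2 * this
    have h3 : vertex₁ t * ((-2 * offset g t : ℝ) * axis g t) + axis g t ^ 2 = -g := by
      have hN' := hN.ne'
      apply Complex.ext
      · simp only [axis, vertex₁, offset, Complex.add_re, Complex.mul_re, Complex.mul_im,
          Complex.ofReal_re, Complex.ofReal_im, Complex.neg_re, sq]
        field_simp
        linear_combination (g * (1 - g ^ 2) + (1 - g ^ 2) - (1 + g) ^ 2) * hcs + g * hN2
      · simp only [axis, vertex₁, offset, Complex.add_im, Complex.mul_re, Complex.mul_im,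
          Complex.ofReal_re, Complex.ofReal_im, Complex.neg_im, sq]
        field_simp
        ring
    linear_combination vertex₁ t * h1 + h2 + h3

theorem continuous_radius (g : ℝ) : Continuous (radius g) := by
  unfold radius; fun_prop

theorem continuous_offset (hg : |g| < 1) : Continuous (offset g) :=
  continuous_const.div (continuous_const.mul (continuous_radius g))
    fun t => (mul_pos two_pos (radius_pos hg t)).ne'

theorem continuous_halfSide (hg : |g| < 1) : Continuous (halfSide g) := by
  have := continuous_offset hg
  unfold halfSide; fun_prop

theorem continuous_mk {f₁ f₂ : ℝ → ℝ} (h₁ : Continuous f₁) (h₂ : Continuous f₂) :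
    Continuous fun t => (⟨f₁ t, f₂ t⟩ : ℂ) := by
  have : (fun t => (⟨f₁ t, f₂ t⟩ : ℂ)) = fun t => (f₁ t : ℂ) + f₂ t * Complex.I := by
    ext t; exact Complex.mk_eq_add_mul_I _ _
  rw [this]
  fun_prop

theorem continuous_axis (hg : |g| < 1) : Continuous (axis g) := by
  have h := continuous_radius g
  have h0 : ∀ t, radius g t ≠ 0 := fun t => (radius_pos hg t).ne'
  exact continuous_mk ((by fun_prop : Continuous fun t => (1 - g) * Real.cos t).div h h0)
    ((by fun_prop : Continuous fun t => (1 + g) * Real.sin t).div h h0)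

theorem continuous_vertex₁ : Continuous vertex₁ :=
  continuous_mk Real.continuous_cos Real.continuous_sin

theorem continuous_vertex₂ (hg : |g| < 1) : Continuous (vertex₂ g) :=
  (continuous_axis hg).mul (continuous_mk (continuous_offset hg).neg (continuous_halfSide hg))

theorem continuous_vertex₃ (hg : |g| < 1) : Continuous (vertex₃ g) :=
  (continuous_axis hg).mul (continuous_mk (continuous_offset hg).neg (continuous_halfSide hg).neg)

theorem continuous_chord {f₁ f₂ : ℝ → ℂ} (h₁ : Continuous f₁) (h₂ : Continuous f₂) :
    Continuous fun t => chord (f₁ t) (f₂ t) := by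
  unfold chord; fun_prop

theorem continuous_side₁ (hg : |g| < 1) : Continuous (side₁ g) :=
  continuous_chord (continuous_vertex₂ hg) (continuous_vertex₃ hg)

theorem continuous_side₂ (hg : |g| < 1) : Continuous (side₂ g) :=
  continuous_chord (continuous_vertex₃ hg) continuous_vertex₁

theorem continuous_side₃ (hg : |g| < 1) : Continuous (side₃ g) :=
  continuous_chord continuous_vertex₁ (continuous_vertex₂ hg)

theorem continuous_den162 {s₁ s₂ s₃ : ℝ → ℝ} (h₁ : Continuous s₁) (h₂ : Continuous s₂)
    (h₃ : Continuous s₃) : Continuous fun t => den162 (s₁ t) (s₂ t) (s₃ t) := by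
  unfold den162; fun_prop

theorem continuous_weightSum_side (hg : |g| < 1) :
    Continuous fun t => weightSum (side₁ g t) (side₂ g t) (side₃ g t) := by
  have h₁ := continuous_side₁ hg
  have h₂ := continuous_side₂ hg
  have h₃ := continuous_side₃ hg
  unfold weightSum den162
  fun_prop

theorem continuous_centerMotion (hg : |g| < 1)
    (h : ∀ t, weightSum (side₁ g t) (side₂ g t) (side₃ g t) ≠ 0) :
    Continuous (centerMotion g) := by
  have h₁ := continuous_side₁ hg
  have h₂ := continuous_side₂ hg
  have h₃ := continuous_side₃ hg
  have v₁ := continuous_vertex₁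
  have v₂ := continuous_vertex₂ hg
  have v₃ := continuous_vertex₃ hg
  have p := continuous_den162 h₁ h₂ h₃
  have q := continuous_den162 h₂ h₃ h₁
  have r := continuous_den162 h₃ h₁ h₂
  refine Continuous.div ?_ (Complex.continuous_ofReal.comp (continuous_weightSum_side hg))
    fun t => Complex.ofReal_ne_zero.2 (h t)
  fun_prop

/-! ### The velocity of the center at the isosceles triangles -/

theorem side₂_sub_side₃ (g t : ℝ) :
    side₂ g t - side₃ g t = Real.sin (2 * t) * (-2 * g * halfSide g t / radius g t) := by
  rw [Real.sin_two_mul, side₂, side₃, chord_eq, chord_eq]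
  simp only [vertex₁, vertex₂, vertex₃, axis, Complex.mul_re, Complex.mul_im]
  ring

theorem den162_side (g t : ℝ) : den162 (side₁ g t) (side₂ g t) (side₃ g t) =
    Real.sin (2 * t) * (-2 * g * halfSide g t / radius g t * (side₂ g t + side₃ g t) *
      (side₂ g t ^ 2 + side₃ g t ^ 2 - side₁ g t ^ 2)) := by
  rw [den162]
  linear_combination (side₂ g t + side₃ g t) *
    (side₂ g t ^ 2 + side₃ g t ^ 2 - side₁ g t ^ 2) * side₂_sub_side₃ g t

/-- The factor `G` in `Im (centerMotion g t) = sin t + sin (2 t) G t`. -/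
def imFactor (g t : ℝ) : ℝ :=
  (-2 * g * halfSide g t / radius g t * (side₂ g t + side₃ g t) *
    (side₂ g t ^ 2 + side₃ g t ^ 2 - side₁ g t ^ 2)) *
  (side₂ g t * den162 (side₃ g t) (side₁ g t) (side₂ g t) * ((vertex₂ g t).im - Real.sin t) +
    side₃ g t * den162 (side₂ g t) (side₃ g t) (side₁ g t) * ((vertex₃ g t).im - Real.sin t)) /
  weightSum (side₁ g t) (side₂ g t) (side₃ g t)

/-- The second and third weights both contain the first denominator, which has the factor `sin
(2t)`, so the displacement of the center from the first vertex has it too. The derivative at 0 then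
needs only continuity of `imFactor` there. -/
theorem im_centerMotion {t : ℝ} (h : weightSum (side₁ g t) (side₂ g t) (side₃ g t) ≠ 0) :
    (centerMotion g t).im = Real.sin t + Real.sin (2 * t) * imFactor g t := by
  have hp := den162_side g t
  rw [centerMotion, center, Complex.div_ofReal_im, imFactor]
  simp only [Complex.add_im, Complex.im_ofReal_mul]
  rw [div_eq_iff h, add_mul, mul_assoc (Real.sin (2 * t)), div_mul_cancel₀ _ h]
  set k := -2 * g * halfSide g t / radius g t * (side₂ g t + side₃ g t) *
    (side₂ g t ^ 2 + side₃ g t ^ 2 - side₁ g t ^ 2)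
  unfold weightSum
  rw [hp]
  simp only [vertex₁]
  ring

theorem radius_zero (hg : |g| < 1) : radius g 0 = 1 - g := by
  rw [radius, mul_zero, Real.cos_zero, show 1 - 2 * g * 1 + g ^ 2 = (1 - g) ^ 2 by ring,
    Real.sqrt_sq (by linarith [le_abs_self g])]

theorem offset_zero (hg : |g| < 1) : offset g 0 = (1 + g) / 2 := by
  have : 1 - g ≠ 0 := by linarith [le_abs_self g]
  rw [offset, radius_zero hg]
  field_simp
  ring

theorem axis_zero (hg : |g| < 1) : axis g 0 = 1 := by
  have : 1 - g ≠ 0 := by linarith [le_abs_self g]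
  apply Complex.ext <;> simp [axis, radius_zero hg, this]

theorem vertex₁_zero : vertex₁ 0 = 1 := by
  apply Complex.ext <;> simp [vertex₁]

theorem vertex₂_zero (hg : |g| < 1) : vertex₂ g 0 = ⟨-((1 + g) / 2), halfSide g 0⟩ := by
  rw [vertex₂, axis_zero hg, one_mul, offset_zero hg]

theorem vertex₃_zero (hg : |g| < 1) : vertex₃ g 0 = ⟨-((1 + g) / 2), -halfSide g 0⟩ := by
  rw [vertex₃, axis_zero hg, one_mul, offset_zero hg]

theorem halfSide_zero_sq (hg : |g| < 1) : halfSide g 0 ^ 2 = (1 - g) * (3 + g) / 4 := by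
  rw [halfSide_sq hg, offset_zero hg]; ring

theorem side₁_zero (hg : |g| < 1) : side₁ g 0 = (1 - g) * ((3 + g) / 2) := by
  rw [side₁, chord_eq, vertex₂_zero hg, vertex₃_zero hg]
  linear_combination halfSide_zero_sq hg

theorem side₂_zero (hg : |g| < 1) : side₂ g 0 = (3 + g) / 2 := by
  rw [side₂, chord_eq, vertex₃_zero hg, vertex₁_zero]
  simp only [Complex.one_re, Complex.one_im]
  ring

theorem side₃_zero (hg : |g| < 1) : side₃ g 0 = (3 + g) / 2 := by
  rw [side₃, chord_eq, vertex₂_zero hg, vertex₁_zero]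
  simp only [Complex.one_re, Complex.one_im]
  ring

theorem weightSum_isosceles (g s : ℝ) :
    weightSum ((1 - g) * s) s s = -((1 - g) ^ 5 * g ^ 2 * (2 - g) ^ 2 * s ^ 9) := by
  unfold weightSum den162; ring

theorem weightSum_side_zero (hg : |g| < 1) (hg0 : g ≠ 0) :
    weightSum (side₁ g 0) (side₂ g 0) (side₃ g 0) ≠ 0 := by
  have h1 := le_abs_self g
  have h2 := neg_abs_le g
  rw [side₁_zero hg, side₂_zero hg, side₃_zero hg, weightSum_isosceles]
  have h3 : 0 < 1 - g := by linarith
  have h4 : 0 < 2 - g := by linarith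
  have h5 : 0 < (3 + g) / 2 := by linarith
  exact neg_ne_zero.2 (by positivity)

theorem centerMotion_zero (hg : |g| < 1) (hg0 : g ≠ 0) : centerMotion g 0 = 1 := by
  have h := weightSum_side_zero hg hg0
  have hp := den162_side g 0
  rw [mul_zero, Real.sin_zero, zero_mul] at hp
  rw [centerMotion, center, div_eq_iff (Complex.ofReal_ne_zero.2 h), weightSum, hp, vertex₁_zero]
  simp

theorem imFactor_zero (hg : |g| < 1) (hg0 : g ≠ 0) :
    imFactor g 0 = -(4 * (1 + 2 * g - g ^ 2) / ((1 - g) ^ 3 * (2 - g))) := by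
  have h1 := le_abs_self g
  have h2 := neg_abs_le g
  have h3 : 1 - g ≠ 0 := by linarith
  have h4 : 2 - g ≠ 0 := by linarith
  have h5 : 3 + g ≠ 0 := by linarith
  have h6 := halfSide_zero_sq hg
  rw [imFactor, side₁_zero hg, side₂_zero hg, side₃_zero hg, weightSum_isosceles,
    radius_zero hg, vertex₂_zero hg, vertex₃_zero hg, Real.sin_zero]
  generalize halfSide g 0 = H at *
  have h7 : (3 + g) / 2 ≠ 0 := div_ne_zero h5 two_ne_zero
  have h8 : H ^ 2 = (1 - g) * ((3 + g) / 2) / 2 := by rw [h6]; ring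
  generalize (3 + g) / 2 = s at *
  have : ∀ x : ℝ, x = -2 * g * H / (1 - g) * (s + s) * (s ^ 2 + s ^ 2 - ((1 - g) * s) ^ 2) *
      (s * den162 s ((1 - g) * s) s * (H - 0) + s * den162 s s ((1 - g) * s) * (-H - 0)) →
      x = 4 * (1 + 2 * g - g ^ 2) * (1 - g) ^ 2 * g ^ 2 * (2 - g) * s ^ 9 := by
    rintro x rfl
    have : -2 * g * H / (1 - g) * (s + s) * (s ^ 2 + s ^ 2 - ((1 - g) * s) ^ 2) *
      (s * den162 s ((1 - g) * s) s * (H - 0) + s * den162 s s ((1 - g) * s) * (-H - 0)) =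
      8 * g ^ 2 * (1 + 2 * g - g ^ 2) * (1 - g) ^ 2 * (2 - g) * s ^ 8 * H ^ 2 / (1 - g) := by
      unfold den162; ring
    rw [this, h8]
    field_simp
    ring
  rw [this _ rfl]
  field_simp

theorem continuousAt_imFactor (hg : |g| < 1) (hg0 : g ≠ 0) : ContinuousAt (imFactor g) 0 := by
  have h₁ := continuous_side₁ hg
  have h₂ := continuous_side₂ hg
  have h₃ := continuous_side₃ hg
  have v₂ := continuous_vertex₂ hg
  have v₃ := continuous_vertex₃ hg
  have q := continuous_den162 h₂ h₃ h₁
  have r := continuous_den162 h₃ h₁ h₂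
  have k : Continuous fun t => -2 * g * halfSide g t / radius g t :=
    (continuous_const.mul (continuous_halfSide hg)).div (continuous_radius g)
      fun t => (radius_pos hg t).ne'
  refine ContinuousAt.div ?_ (continuous_weightSum_side hg).continuousAt
    (weightSum_side_zero hg hg0)
  have i₂ := (Complex.continuous_im.comp v₂).sub Real.continuous_sin
  have i₃ := (Complex.continuous_im.comp v₃).sub Real.continuous_sin
  exact ((k.mul (h₂.add h₃)).mul (by fun_prop)).mul
    (((h₂.mul r).mul i₂).add ((h₃.mul q).mul i₃)) |>.continuousAt

open Filter Topology in
theorem hasDerivAt_mul_of_continuousAt {f F : ℝ → ℝ} {f' x : ℝ} (hf : HasDerivAt f f' x)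
    (h0 : f x = 0) (hF : ContinuousAt F x) : HasDerivAt (fun t => f t * F t) (f' * F x) x := by
  rw [hasDerivAt_iff_tendsto_slope] at hf ⊢
  have h := hf.mul (hF.tendsto.mono_left nhdsWithin_le_nhds)
  refine h.congr fun t => ?_
  simp only [slope_def_field, h0]
  ring

/-- The angular velocity of the center when it passes through `1`. -/
theorem hasDerivAt_im_centerMotion (hg : |g| < 1) (hg0 : g ≠ 0) :
    HasDerivAt (fun t => (centerMotion g t).im)
      (1 - 8 * (1 + 2 * g - g ^ 2) / ((1 - g) ^ 3 * (2 - g))) 0 := by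
  have h1 : HasDerivAt (fun t : ℝ => Real.sin (2 * t)) 2 0 := by
    have := ((hasDerivAt_id (0 : ℝ)).const_mul 2).sin
    simpa using this
  have h2 := hasDerivAt_mul_of_continuousAt h1 (by simp) (continuousAt_imFactor hg hg0)
  have h3 := (Real.hasDerivAt_sin 0).add h2
  rw [Real.cos_zero, imFactor_zero hg hg0] at h3
  have h4 := h3.congr_of_eventuallyEq (f₁ := fun t => (centerMotion g t).im) ?_
  · refine h4.congr_deriv ?_
    ring
  -- For negative `g` the weight sum is known to be nonzero only at `t = 0`, hence near 0, which is
  -- enough for a derivative.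
  · filter_upwards [(continuous_weightSum_side hg).continuousAt.eventually_ne
      (weightSum_side_zero hg hg0)] with t ht
    exact im_centerMotion ht

/-! ### A quarter turn exchanges the roles of the axes -/

theorem radius_add_pi_div_two (g t : ℝ) : radius g (t + Real.pi / 2) = radius (-g) t := by
  rw [radius, radius, show 2 * (t + Real.pi / 2) = 2 * t + Real.pi by ring, Real.cos_add_pi]
  congr 1
  ring

theorem offset_add_pi_div_two (g t : ℝ) : offset g (t + Real.pi / 2) = offset (-g) t := by
  rw [offset, offset, radius_add_pi_div_two, neg_sq]

theorem halfSide_add_pi_div_two (g t : ℝ) : halfSide g (t + Real.pi / 2) = halfSide (-g) t := by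
  rw [halfSide, halfSide, offset_add_pi_div_two]

theorem axis_add_pi_div_two (g t : ℝ) : axis g (t + Real.pi / 2) = Complex.I * axis (-g) t := by
  apply Complex.ext
  · simp only [axis, radius_add_pi_div_two, Real.cos_add_pi_div_two, Complex.I_mul_re]
    ring
  · simp only [axis, radius_add_pi_div_two, Real.sin_add_pi_div_two, Complex.I_mul_im]
    ring

theorem vertex₁_add_pi_div_two (t : ℝ) : vertex₁ (t + Real.pi / 2) = Complex.I * vertex₁ t := by
  apply Complex.ext <;>
    simp [vertex₁, Real.cos_add_pi_div_two, Real.sin_add_pi_div_two]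

theorem vertex₂_add_pi_div_two (g t : ℝ) :
    vertex₂ g (t + Real.pi / 2) = Complex.I * vertex₂ (-g) t := by
  rw [vertex₂, vertex₂, axis_add_pi_div_two, offset_add_pi_div_two, halfSide_add_pi_div_two,
    mul_assoc]

theorem vertex₃_add_pi_div_two (g t : ℝ) :
    vertex₃ g (t + Real.pi / 2) = Complex.I * vertex₃ (-g) t := by
  rw [vertex₃, vertex₃, axis_add_pi_div_two, offset_add_pi_div_two, halfSide_add_pi_div_two,
    mul_assoc]

theorem chord_I_mul (u v : ℂ) : chord (Complex.I * u) (Complex.I * v) = chord u v := by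
  simp only [chord_eq, Complex.I_mul_re, Complex.I_mul_im]
  ring

theorem centerMotion_add_pi_div_two (g t : ℝ) :
    centerMotion g (t + Real.pi / 2) = Complex.I * centerMotion (-g) t := by
  simp only [centerMotion, side₁, side₂, side₃, vertex₁_add_pi_div_two, vertex₂_add_pi_div_two,
    vertex₃_add_pi_div_two, chord_I_mul, center]
  ring

end

/-! ### The motion of `X₁₆₂` -/

section
variable {a b g : ℝ}

/-- Chords are half squared distances and need not obey the triangle inequality in general. Here
they do, being proportional to the sides of a triangle inscribed in the ellipse. -/
theorem weightSum_side_ne_zero (hb : 0 < b) (hab : b < a) (hg : IsInvariant a b g) (t : ℝ) :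
    weightSum (side₁ g t) (side₂ g t) (side₃ g t) ≠ 0 := by
  have hg1 : |g| < 1 := by rw [abs_of_pos hg.pos]; exact hg.lt_one
  have h := isTriple_vertex hg1 t
  have e₁ := h.rotate.chord_eq_mul_dist hb hab hg
  have e₂ := h.rotate.rotate.chord_eq_mul_dist hb hab hg
  have e₃ := h.chord_eq_mul_dist hb hab hg
  set P₁ := pt a b (vertex₁ t)
  set P₂ := pt a b (vertex₂ g t)
  set P₃ := pt a b (vertex₃ g t)
  have hJ := Real.sqrt_nonneg (g / (a ^ 2 - b ^ 2))
  have tri : ∀ P Q R : Plane, √(g / (a ^ 2 - b ^ 2)) * dist P R ≤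
      √(g / (a ^ 2 - b ^ 2)) * dist R Q + √(g / (a ^ 2 - b ^ 2)) * dist Q P := by
    intro P Q R
    rw [← mul_add, dist_comm P R]
    exact mul_le_mul_of_nonneg_left (dist_triangle R Q P) hJ
  apply weightSum_ne_zero (chord_pos h.norm₂ h.norm₃ (h.rotate.ne hg1))
    (chord_pos h.norm₃ h.norm₁ (h.rotate.rotate.ne hg1)) (chord_pos h.norm₁ h.norm₂ (h.ne hg1))
  · rw [e₁, e₂, e₃]
    exact tri P₂ P₁ P₃
  · rw [e₁, e₂, e₃, add_comm]
    linarith [tri P₃ P₂ P₁]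
  · rw [e₁, e₂, e₃]
    linarith [tri P₁ P₃ P₂]
  · rintro ⟨h₁, h₂⟩
    exact h.not_equilateral hg1 hg.pos.ne' (h₂.symm.trans h₁.symm) h₁

theorem X162_eq_pt_centerMotion (hb : 0 < b) (hab : b < a) (hg : IsInvariant a b g) {t : ℝ}
    {P₂ P₃ : Plane} (h : IsThreePeriodic a b (point a b t) P₂ P₃) :
    X162 (point a b t) P₂ P₃ = pt a b (centerMotion g t) := by
  have hg1 : |g| < 1 := by rw [abs_of_pos hg.pos]; exact hg.lt_one
  have hc : 0 < a ^ 2 - b ^ 2 := sub_pos.2 (by gcongr)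
  have hJ : √(g / (a ^ 2 - b ^ 2)) ≠ 0 := (Real.sqrt_pos.2 (div_pos hg.pos hc)).ne'
  obtain ⟨v, hv, rfl⟩ := exists_pt_of_mem_boundary (hb.trans hab).ne' hb.ne' h.mem₂
  obtain ⟨w, hw, rfl⟩ := exists_pt_of_mem_boundary (hb.trans hab).ne' hb.ne' h.mem₃
  rw [point_eq_pt, ← vertex₁_eq_exp] at h ⊢
  have ht := (isThreePeriodic_pt_iff hb hab hg (norm_vertex₁ t) hv hw).1 h
  rw [X162_pt, ← center_mul hJ, ← ht.rotate.chord_eq_mul_dist hb hab hg,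
    ← ht.rotate.rotate.chord_eq_mul_dist hb hab hg, ← ht.chord_eq_mul_dist hb hab hg]
  congr 1
  -- The given trajectory may label its last two vertices in either order, independently for each
  -- `t`; the center is symmetric in them.
  rcases (isTriple_vertex hg1 t).eq_or_eq hg1 ht with ⟨rfl, rfl⟩ | ⟨rfl, rfl⟩
  · rfl
  · rw [← center_swap, chord_comm (vertex₃ g t), chord_comm (vertex₁ t) (vertex₃ g t),
      chord_comm (vertex₂ g t) (vertex₁ t)]
    rfl

theorem exists_isThreePeriodic (hb : 0 < b) (hab : b < a) (hg : IsInvariant a b g) (t : ℝ) :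
    ∃ P₂ P₃ : Plane, IsThreePeriodic a b (point a b t) P₂ P₃ := by
  have hg1 : |g| < 1 := by rw [abs_of_pos hg.pos]; exact hg.lt_one
  have h := isTriple_vertex hg1 t
  refine ⟨pt a b (vertex₂ g t), pt a b (vertex₃ g t), ?_⟩
  rw [point_eq_pt, ← vertex₁_eq_exp]
  exact (isThreePeriodic_pt_iff hb hab hg h.norm₁ h.norm₂ h.norm₃).2 h

theorem sin_sub_eq_im {W : ℝ → ℂ} {θ : ℝ → ℝ} (h : ∀ t, W t = Complex.exp (θ t * Complex.I))
    (s t : ℝ) : Real.sin (θ t - θ s) = (W t / W s).im := by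
  rw [h, h, ← Complex.exp_sub, ← sub_mul, ← Complex.ofReal_sub, Complex.exp_ofReal_mul_I_im]

theorem angular_velocity_neg (h0 : 0 < g) (h1 : g < 1) :
    1 - 8 * (1 + 2 * g - g ^ 2) / ((1 - g) ^ 3 * (2 - g)) < 0 := by
  have h2 : 0 < (1 - g) ^ 3 * (2 - g) := mul_pos (pow_pos (by linarith) 3) (by linarith)
  -- A crude bound suffices, since `8(1 + 2g - g²) > 8`.
  have h3 : (1 - g) ^ 3 * (2 - g) ≤ 1 * 2 :=
    mul_le_mul (pow_le_one₀ (by linarith) (by linarith)) (by linarith) (by linarith) zero_le_one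
  rw [sub_neg, one_lt_div h2]
  nlinarith

theorem angular_velocity_pos (h0 : 0 < g)
    (h : 0 < g ^ 4 + 5 * g ^ 3 + 17 * g ^ 2 + 23 * g - 6) :
    0 < 1 - 8 * (1 + 2 * -g - (-g) ^ 2) / ((1 - -g) ^ 3 * (2 - -g)) := by
  have h2 : 0 < (1 - -g) ^ 3 * (2 - -g) := mul_pos (pow_pos (by linarith) 3) (by linarith)
  rw [sub_pos, div_lt_one h2]
  linarith

theorem nonMonotonicMotion_pt_centerMotion (hb : 0 < b) (hab : b < a) (hg : IsInvariant a b g)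
    (h : 0 < poly162 (a / b)) : NonMonotonicMotion a b fun t => pt a b (centerMotion g t) := by
  have hg1 : |g| < 1 := by rw [abs_of_pos hg.pos]; exact hg.lt_one
  have hg0 : g ≠ 0 := hg.pos.ne'
  have hw := weightSum_side_ne_zero hb hab hg
  have ht := isTriple_vertex hg1
  constructor
  · obtain ⟨θ, hθ, h⟩ := exists_continuous_lift (continuous_centerMotion hg1 hw)
      fun t => norm_center (ht t).norm₁ (ht t).norm₂ (ht t).norm₃ (hw t)
    exact ⟨θ, hθ, fun t => by rw [point_eq_pt, ← h]⟩
  · rintro θ ⟨hθ, hX⟩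
    have hW : ∀ t, centerMotion g t = Complex.exp (θ t * Complex.I) := fun t =>
      pt_injective (hb.trans hab).ne' hb.ne' ((hX t).trans (point_eq_pt _))
    have d₁ : HasDerivAt (fun t => Real.sin (θ t - θ 0))
        (1 - 8 * (1 + 2 * g - g ^ 2) / ((1 - g) ^ 3 * (2 - g))) 0 := by
      simp_rw [sin_sub_eq_im hW, centerMotion_zero hg1 hg0, div_one]
      exact hasDerivAt_im_centerMotion hg1 hg0
    have hg1' : |-g| < 1 := by rwa [abs_neg]
    have hg0' : -g ≠ 0 := neg_ne_zero.2 hg0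
    have hW' : ∀ t, centerMotion g (t + Real.pi / 2) =
        Complex.exp (θ (t + Real.pi / 2) * Complex.I) := fun t => hW _
    have d₂ : HasDerivAt (fun t => Real.sin (θ (t + Real.pi / 2) - θ (0 + Real.pi / 2)))
        (1 - 8 * (1 + 2 * -g - (-g) ^ 2) / ((1 - -g) ^ 3 * (2 - -g))) 0 := by
      -- The factor `I` of the quarter turn cancels in the quotient that measures the angular
      -- increment.
      simp_rw [sin_sub_eq_im (θ := fun t => θ (t + Real.pi / 2)) hW', centerMotion_add_pi_div_two,
        mul_div_mul_left _ _ Complex.I_ne_zero, centerMotion_zero hg1' hg0', div_one]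
      exact hasDerivAt_im_centerMotion hg1' hg0'
    constructor
    · intro hm
      exact (angular_velocity_neg hg.pos hg.lt_one).not_ge (nonneg_of_hasDerivAt_sin hθ hm d₁)
    · intro hm
      have hθ' : Continuous fun t => θ (t + Real.pi / 2) := by fun_prop
      have hm' : Antitone fun t => θ (t + Real.pi / 2) := fun s t hst => hm (by linarith)
      exact (angular_velocity_pos hg.pos (hg.quartic_pos hb h)).not_ge
        (nonpos_of_hasDerivAt_sin hθ' hm' d₂)

end

end EllipticBilliard

end

theorem mainTheorem5 :
    ∃ α : ℝ, (0 < α ∧ EllipticBilliard.poly162 α = 0) ∧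
      (∀ x : ℝ, 0 < x → EllipticBilliard.poly162 x = 0 → x = α) ∧
      |α - 1.1637| < 0.00005 ∧
      ∀ a b : ℝ, 0 < b → α < a / b →
        (∀ t : ℝ, ∃ P₂ P₃ : EllipticBilliard.Plane,
          EllipticBilliard.IsThreePeriodic a b (EllipticBilliard.point a b t) P₂ P₃) ∧
        ∀ P₂ P₃ : ℝ → EllipticBilliard.Plane,
          (∀ t, EllipticBilliard.IsThreePeriodic a b
            (EllipticBilliard.point a b t) (P₂ t) (P₃ t)) →
          EllipticBilliard.NonMonotonicMotion a b
            (fun t => EllipticBilliard.X162 (EllipticBilliard.point a b t) (P₂ t) (P₃ t)) := by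
  open EllipticBilliard in
  obtain ⟨α, h₁, h₂, hα⟩ := exists_poly162_root
  have h0 : 0 < α := by linarith
  refine ⟨α, ⟨h0, hα⟩, fun x hx hx0 =>
    poly162_strictMonoOn.injOn hx h0 (hx0.trans hα.symm), ?_, fun a b hb h => ?_⟩
  · rw [abs_lt]
    constructor <;> linarith
  · have hab : b < a := by
      rw [← one_lt_div hb]
      linarith
    obtain ⟨g, hg⟩ := exists_isInvariant hb hab
    refine ⟨exists_isThreePeriodic hb hab hg, fun P₂ P₃ hP => ?_⟩
    simp_rw [fun t => X162_eq_pt_centerMotion hb hab hg (hP t)]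
    apply nonMonotonicMotion_pt_centerMotion hb hab hg
    have := poly162_strictMonoOn h0 (h0.trans h) h
    rwa [hα] at this
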